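/- For $\mu\in\mathbb R$ and a pair $\boldsymbol\rho=(\rho_1,\rho_2)$ of functions on $\mathbb R$, let $(S^df)(x)=f(x+d)$, $A=S^1+S^{-1}$, $\delta=S^1-S^{-1}$, \[ \mathcal D_\mu=\frac12\begin{bmatrix}(2+\mu)(2-A)&\mu\delta\\-\mu\delta&(2+\mu)(2+A)\end{bmatrix},\qquad \mathcal Q(\boldsymbol\rho,\boldsymbol\rho)=\begin{pmatrix}\rho_1^2+\rho_2^2\\2\rho_1\rho_2\end{pmatrix}, \] and let $\mathcal G_c(\boldsymbol\rho,\mu)=c^2\boldsymbol\rho''+\mathcal D_\mu\boldsymbol\rho+\mathcal D_\mu\mathcal Q(\boldsymbol\rho,\boldsymbol\rho)$ (the traveling-wave operator with wave speed $c$ of the diatomic FPUT lattice with mass ratio $1/m=1+\mu$). Put $\lambda_\mu^+(K)=2+\mu+\sqrt{\mu^2+4(1+\mu)\cos^2K}$. Let $|c|>1$. There is a number $\mu_\omega(c)>0$ such that for every $|\mu|\le\mu_\omega(c)$ there is a unique $\omega_c^\mu>0$ with $c^2(\omega_c^\mu)^2=\lambda_\mu^+(\omega_c^\mu)$. For any such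 $\mu_\omega(c)$ there are $\mu_{\mathrm{per}}(c)\in(0,\min\{\mu_\omega(c),1\})$ and $a_{\mathrm{per}}(c)>0$ such that for all $|\mu|\le\mu_{\mathrm{per}}(c)$ the number \[ \upsilon_c^\mu:=\frac{\mu\sin(\omega_c^\mu)}{\lambda_\mu^+(\omega_c^\mu)-(2+\mu)(1-\cos(\omega_c^\mu))} \] is well defined (the denominator is nonzero) with $|\upsilon_c^\mu|\le C(c)|\mu|$, and there are maps $a\mapsto\omega_c^\mu[a]\in\mathbb R$, $a\mapsto\psi_{c,1}^\mu[a]$ and $a\mapsto\psi_{c,2}^\mu[a]$ on $[-a_{\mathrm{per}}(c),a_{\mathrm{per}}(c)]$, where $\psi_{c,1}^\mu[a]$ is an even and $\psi_{c,2}^\mu[a]$ an odd real-valued, $2\pi$-periodic $C^\infty$ function on $\mathbb R$, with the following properties. (i) If \[ \boldsymbol\phi_c^\mu[a](x)=\begin{pmatrix}\upsilon_c^\mu\cos(\omega_c^\mu[a]x)\\ \sin(\omega_c^\mu[a]x)\end{pmatrix}+\begin{pmatrix}\psi_{c,1}^\mu[a](\omega_c^\mu[a]x)\\ \psi_{c,2}^\mu[a](\omega_c^\mu[a]x)\end{pmatrix},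 \] then $\mathcal G_c(a\boldsymbol\phi_c^\mu[a],\mu)=0$ on $\mathbb R$ for all $|a|\le a_{\mathrm{per}}(c)$. (ii) $\omega_c^\mu[0]=\omega_c^\mu$. (iii) $\psi_{c,1}^\mu[0]=\psi_{c,2}^\mu[0]=0$. (iv) For each integer $r\ge0$ there is $C(c,r)>0$ such that for all $|a|,|\grave a|\le a_{\mathrm{per}}(c)$ and all $|\mu|\le\mu_{\mathrm{per}}(c)$, \[ |\omega_c^\mu[a]-\omega_c^\mu[\grave a]|+\|\psi_{c,1}^\mu[a]-\psi_{c,1}^\mu[\grave a]\|_{W^{r,\infty}(\mathbb R)}+\|\psi_{c,2}^\mu[a]-\psi_{c,2}^\mu[\grave a]\|_{W^{r,\infty}(\mathbb R)}\le C(c,r)|a-\grave a|. \] -/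

import Mathlib

noncomputable section

namespace DiatomicFPUT

/-- Pairs `(ρ₁, ρ₂)` of real-valued profile functions on the line. -/
abbrev Profile := (ℝ → ℝ) × (ℝ → ℝ)

/-- The shift operator `(S^d f)(x) = f(x + d)`. -/
def shift (d : ℝ) (f : ℝ → ℝ) : ℝ → ℝ := fun x => f (x + d)

/-- `A = S^1 + S^{-1}`. -/
def opA (f : ℝ → ℝ) : ℝ → ℝ := shift 1 f + shift (-1) f

/-- `δ = S^1 - S^{-1}`. -/
def opDelta (f : ℝ → ℝ) : ℝ → ℝ := shift 1 f - shift (-1) f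

/-- The operator `D_μ`, i.e. one half of the operator matrix with rows
`(2+μ)(2-A), μδ` and `-μδ, (2+μ)(2+A)`. -/
def opD (μ : ℝ) (ρ : Profile) : Profile :=
  ((1 / 2 : ℝ) • ((2 + μ) • ((2 : ℝ) • ρ.1 - opA ρ.1) + μ • opDelta ρ.2),
   (1 / 2 : ℝ) • (-(μ • opDelta ρ.1) + (2 + μ) • ((2 : ℝ) • ρ.2 + opA ρ.2)))

/-- The symmetric bilinear map `Q(ρ, σ) = (ρ₁σ₁ + ρ₂σ₂, ρ₁σ₂ + σ₁ρ₂)`. -/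
def nonlin (ρ σ : Profile) : Profile :=
  (ρ.1 * σ.1 + ρ.2 * σ.2, ρ.1 * σ.2 + σ.1 * ρ.2)

/-- The second derivative, componentwise. -/
def secondDeriv (ρ : Profile) : Profile := (iteratedDeriv 2 ρ.1, iteratedDeriv 2 ρ.2)

/-- The traveling wave operator `G_c(ρ, μ) = c²ρ'' + D_μ ρ + D_μ Q(ρ, ρ)`. -/
def travelingWaveOp (c : ℝ) (ρ : Profile) (μ : ℝ) : Profile :=
  c ^ 2 • secondDeriv ρ + opD μ ρ + opD μ (nonlin ρ ρ)

/-- The eigenvalue curve `λ_μ^+(K) = 2 + μ + √(μ² + 4(1+μ)cos²K)`. -/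
def lambdaPlus (μ K : ℝ) : ℝ :=
  2 + μ + Real.sqrt (μ ^ 2 + 4 * (1 + μ) * Real.cos K ^ 2)

/-- `ω` is a positive solution of `c²ω² = λ_μ^+(ω)`. -/
def IsCriticalFrequency (c μ ω : ℝ) : Prop :=
  0 < ω ∧ c ^ 2 * ω ^ 2 = lambdaPlus μ ω

/-- `μω > 0` is a threshold below which the critical frequency exists and is unique. -/
def IsFrequencyThreshold (c μω : ℝ) : Prop :=
  0 < μω ∧ ∀ μ : ℝ, |μ| ≤ μω → ∃! ω : ℝ, IsCriticalFrequency c μ ω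

/-- The critical frequency `ω_c^μ`. It is only used below a frequency threshold, where the set
on the right consists of exactly one point. -/
def criticalFrequency (c μ : ℝ) : ℝ := sInf {ω : ℝ | IsCriticalFrequency c μ ω}

/-- The denominator `λ_μ^+(ω_c^μ) - (2+μ)(1 - cos ω_c^μ)` in the definition of `υ_c^μ`. -/
def upsilonDenom (c μ : ℝ) : ℝ :=
  lambdaPlus μ (criticalFrequency c μ) - (2 + μ) * (1 - Real.cos (criticalFrequency c μ))

/-- The coefficient `υ_c^μ` of the leading order profile. -/
def upsilon (c μ : ℝ) : ℝ :=
  μ * Real.sin (criticalFrequency c μ) / upsilonDenom c μ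

/-- Membership in `C_per^∞`: smooth and `2π`-periodic. -/
def IsSmoothPeriodic (f : ℝ → ℝ) : Prop :=
  ContDiff ℝ ((⊤ : ℕ∞) : WithTop ℕ∞) f ∧ Function.Periodic f (2 * Real.pi)

/-- The `W^{r,∞}(ℝ)` norm of a smooth function (for which weak and classical derivatives agree),
with values in `[0, ∞]`. -/
def sobolevInftyNorm (r : ℕ) (f : ℝ → ℝ) : ENNReal :=
  ∑ k ∈ Finset.range (r + 1),
    MeasureTheory.eLpNorm (iteratedDeriv k f) ⊤ MeasureTheory.volume

/-- The profile `x ↦ (υ cos(ωx) + ψ₁(ωx), sin(ωx) + ψ₂(ωx))`. -/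
def periodicProfile (υ ω : ℝ) (ψ₁ ψ₂ : ℝ → ℝ) : Profile :=
  (fun x => υ * Real.cos (ω * x) + ψ₁ (ω * x), fun x => Real.sin (ω * x) + ψ₂ (ω * x))

end DiatomicFPUT

end

noncomputable section

namespace DiatomicFPUT

/-! After the scaling `y = ωx`, a pair (even, odd) of `2π`-periodic functions is encoded by one real
sequence `p` in `ℓ¹(ℤ)`, as `∑ 2^{-|k|} p_k (cos ky, sin ky)`. Parity is built in, and the
exponential weight bounds every derivative by the `ℓ¹` norm, so a single Lipschitz estimate for `p`
yields all the `W^{r,∞}` estimates. The quadratic term becomes a bounded bilinear map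
(`evenPart_conv`, `oddPart_conv`), and `D_μ` couples only the modes `k` and `-k` (`fullOp_apply`).

The proof is a Lyapunov–Schmidt reduction. Write the wave as `a` times `(α cos y, sin y)` plus modes
`|k| ≥ 2`, and divide the equation by `a`. Mode 0 is trivial, the modes `±1` give two scalar
equations, and the others are inverted by `∂⁻²`, which also makes the frequency-dependent shifts
`C¹` in operator norm (`hasDerivAt_cutMult`). At `μ = a = 0` the linearization in `(ω, α, p)` is
diagonal and invertible: at the monatomic frequency `ω₀` one has `cos ω₀, sin ω₀ > 0` and `c²ω₀² = 2
+ 2 cos ω₀ > 2`, while the operator on the high modes has norm at most `7/4` before division by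
`c²ω₀²`. The implicit function theorem applied jointly in `(μ, a)` makes all constants uniform in
`μ` (`exists_branch`).

At `a = 0` the high modes vanish, and eliminating `α` leaves the dispersion relation; uniqueness of
its positive root identifies `ω` with `ω_c^μ` and `α` with `υ_c^μ`
(`bifurcationMap_zero_amplitude`). That uniqueness holds for small `μ` because `λ_μ^+` grows more
slowly than `c²ω²` (`lambdaPlus_sub_le`). -/

/-- The space `ℓ¹(ℤ)` of absolutely summable real sequences. -/
abbrev Ell1 := lp (fun _ : ℤ => ℝ) 1

/-! ### Bounded linear maps on `ℓ¹(ℤ)`. -/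

namespace Ell1

/-- The unit vectors of `ℓ¹(ℤ)`. -/
def basisVec (k : ℤ) : Ell1 := lp.single 1 k 1

lemma norm_basisVec (k : ℤ) : ‖basisVec k‖ = 1 := by
  simp [basisVec, lp.norm_single]

lemma basisVec_apply (k j : ℤ) : basisVec k j = if j = k then 1 else 0 := by
  simp [basisVec, lp.single_apply, Pi.single_apply]

lemma hasSum_abs (p : Ell1) : HasSum (fun k => |p k|) ‖p‖ := by
  have := lp.hasSum_norm (p := 1) (by simp) p
  simpa using this

lemma hasSum_basisVec (p : Ell1) : HasSum (fun k => p k • basisVec k) p := by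
  have := lp.hasSum_single (p := 1) (by simp) p
  convert this using 2 with k
  rw [basisVec, ← lp.single_smul, smul_eq_mul, mul_one]

section Lift

variable {F : Type*} [NormedAddCommGroup F] [NormedSpace ℝ F]

/-- Continuous linear maps on `ℓ¹(ℤ)` are determined by their values on unit vectors. -/
lemma clm_ext {S T : Ell1 →L[ℝ] F} (h : ∀ k, S (basisVec k) = T (basisVec k)) : S = T := by
  ext1 p
  have hS := (hasSum_basisVec p).mapL S
  have hT := (hasSum_basisVec p).mapL T
  simp only [map_smul, h] at hS hT
  exact hS.unique hT

/-- The operator norm on `ℓ¹(ℤ)` is controlled by the unit vectors. -/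
lemma opNorm_le (T : Ell1 →L[ℝ] F) {C : ℝ} (h : ∀ k, ‖T (basisVec k)‖ ≤ C) : ‖T‖ ≤ C := by
  refine T.opNorm_le_bound ((norm_nonneg _).trans (h 0)) fun p => ?_
  have hT := (hasSum_basisVec p).mapL T
  rw [← hT.tsum_eq]
  refine tsum_of_norm_bounded ((hasSum_abs p).mul_left C) fun k => ?_
  rw [map_smul, norm_smul, Real.norm_eq_abs, mul_comm]
  exact mul_le_mul_of_nonneg_right (h k) (abs_nonneg _)

variable [CompleteSpace F]

lemma summable_smul {v : ℤ → F} {C : ℝ} (hv : ∀ k, ‖v k‖ ≤ C) (p : Ell1) :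
    Summable fun k => p k • v k := by
  refine Summable.of_norm_bounded ((hasSum_abs p).summable.mul_right C) fun k => ?_
  rw [norm_smul, Real.norm_eq_abs]
  exact mul_le_mul_of_nonneg_left (hv k) (abs_nonneg _)

/-- The continuous linear map on `ℓ¹(ℤ)` that sends the unit vectors to a given bounded family. -/
def lift (v : ℤ → F) (hv : ∃ C, ∀ k, ‖v k‖ ≤ C) : Ell1 →L[ℝ] F :=
  LinearMap.mkContinuousOfExistsBound
    { toFun := fun p => ∑' k, p k • v k
      map_add' := fun p q => by
        obtain ⟨C, hC⟩ := hv
        rw [← (summable_smul hC p).tsum_add (summable_smul hC q)]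
        exact tsum_congr fun k => add_smul _ _ _
      map_smul' := fun a p => by
        obtain ⟨C, hC⟩ := hv
        rw [RingHom.id_apply, ← (summable_smul hC p).tsum_const_smul]
        exact tsum_congr fun k => mul_smul _ _ _ }
    (by
      obtain ⟨C, hC⟩ := hv
      refine ⟨C, fun p => ?_⟩
      refine tsum_of_norm_bounded ((hasSum_abs p).mul_left C) fun k => ?_
      rw [norm_smul, Real.norm_eq_abs, mul_comm]
      exact mul_le_mul_of_nonneg_right (hC k) (abs_nonneg _))

lemma lift_apply (v : ℤ → F) (hv : ∃ C, ∀ k, ‖v k‖ ≤ C) (p : Ell1) :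
    lift v hv p = ∑' k, p k • v k := rfl

@[simp] lemma lift_basisVec (v : ℤ → F) (hv : ∃ C, ∀ k, ‖v k‖ ≤ C) (k : ℤ) :
    lift v hv (basisVec k) = v k := by
  rw [lift_apply, tsum_eq_single k]
  · simp [basisVec_apply]
  · intro j hj
    simp [basisVec_apply, hj]

end Lift

/-- The `k`-th coordinate. -/
def coord (k : ℤ) : Ell1 →L[ℝ] ℝ := lp.evalCLM ℝ (fun _ : ℤ => ℝ) 1 k

lemma coord_apply (k : ℤ) (p : Ell1) : coord k p = p k := rfl

/-! ### Exponentially weighted trigonometric series. -/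

/-- The exponential weight `2^{-|k|}`. -/
def weight (k : ℤ) : ℝ := (1 / 2) ^ k.natAbs

lemma weight_pos (k : ℤ) : 0 < weight k := by
  unfold weight; positivity

lemma weight_neg (k : ℤ) : weight (-k) = weight k := by
  simp [weight]

lemma weight_mul_le {i j k : ℤ} (h : k.natAbs ≤ i.natAbs + j.natAbs) :
    weight i * weight j ≤ weight k := by
  rw [weight, weight, weight, ← pow_add]
  exact pow_le_pow_of_le_one (by norm_num) (by norm_num) h

lemma exists_weight_mul_pow_le (n : ℕ) : ∃ C, ∀ k : ℤ, |weight k * (k : ℝ) ^ n| ≤ C := by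
  have h := tendsto_pow_const_mul_const_pow_of_abs_lt_one n (r := (1 / 2 : ℝ))
    (by norm_num [abs_of_pos])
  obtain ⟨C, hC⟩ := h.bddAbove_range
  refine ⟨C, fun k => ?_⟩
  have := hC ⟨k.natAbs, rfl⟩
  rw [abs_mul, abs_of_pos (weight_pos k), abs_pow, weight, mul_comm]
  simpa [Nat.cast_natAbs] using this

lemma exists_trig_le (n : ℕ) :
    ∃ C, ∀ (φ y : ℝ) (k : ℤ), ‖weight k * (k : ℝ) ^ n * Real.cos (k * y + φ)‖ ≤ C := by
  obtain ⟨C, hC⟩ := exists_weight_mul_pow_le n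
  refine ⟨C, fun φ y k => ?_⟩
  rw [norm_mul, Real.norm_eq_abs, Real.norm_eq_abs]
  exact (mul_le_of_le_one_right (abs_nonneg _) (Real.abs_cos_le_one _)).trans (hC k)

/-- Evaluation of the weighted series `∑ 2^{-|k|} kⁿ p_k cos (k y + φ)`. -/
def trigEval (n : ℕ) (φ y : ℝ) : Ell1 →L[ℝ] ℝ :=
  lift (fun k => weight k * (k : ℝ) ^ n * Real.cos (k * y + φ))
    ((exists_trig_le n).imp fun _ h => h φ y)

@[simp] lemma trigEval_basisVec (n : ℕ) (φ y : ℝ) (k : ℤ) :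
    trigEval n φ y (basisVec k) = weight k * (k : ℝ) ^ n * Real.cos (k * y + φ) :=
  lift_basisVec _ _ _

lemma trigEval_apply (n : ℕ) (φ y : ℝ) (p : Ell1) :
    trigEval n φ y p = ∑' k, p k * (weight k * (k : ℝ) ^ n * Real.cos (k * y + φ)) := rfl

lemma exists_norm_trigEval_le (n : ℕ) :
    ∃ C, 0 ≤ C ∧ ∀ (φ y : ℝ) (p : Ell1), |trigEval n φ y p| ≤ C * ‖p‖ := by
  obtain ⟨C, hC⟩ := exists_trig_le n
  refine ⟨C, (norm_nonneg _).trans (hC 0 0 0), fun φ y p => ?_⟩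
  exact (trigEval n φ y).le_of_opNorm_le (opNorm_le _ fun k => by simpa using hC φ y k) p

/-- Differentiation raises the power of `k` by one and advances the phase by `π/2`, so the family
indexed by `n` and `φ` is closed under it. -/
lemma hasDerivAt_trigEval (n : ℕ) (φ y : ℝ) (p : Ell1) :
    HasDerivAt (fun y => trigEval n φ y p) (trigEval (n + 1) (φ + Real.pi / 2) y p) y := by
  obtain ⟨C, hC⟩ := exists_trig_le (n + 1)
  obtain ⟨C₀, hC₀⟩ := exists_trig_le n
  have hterm : ∀ (k : ℤ) (x : ℝ), HasDerivAt
      (fun x => p k * (weight k * (k : ℝ) ^ n * Real.cos (k * x + φ)))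
      (p k * (weight k * (k : ℝ) ^ (n + 1) * Real.cos (k * x + (φ + Real.pi / 2)))) x := by
    intro k x
    have h : HasDerivAt (fun x : ℝ => (k : ℝ) * x + φ) k x := by
      simpa using ((hasDerivAt_id x).const_mul (k : ℝ)).add_const φ
    refine ((h.cos.const_mul (weight k * (k : ℝ) ^ n)).const_mul (p k)).congr_deriv ?_
    rw [← add_assoc, Real.cos_add_pi_div_two]
    ring
  have hbound : ∀ (k : ℤ) (x : ℝ),
      ‖p k * (weight k * (k : ℝ) ^ (n + 1) * Real.cos (k * x + (φ + Real.pi / 2)))‖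
        ≤ |p k| * C := by
    intro k x
    rw [norm_mul, Real.norm_eq_abs (p k)]
    exact mul_le_mul_of_nonneg_left (hC _ _ k) (abs_nonneg _)
  have hsum : Summable fun k =>
      p k * (weight k * (k : ℝ) ^ n * Real.cos (k * (0 : ℝ) + φ)) := by
    simpa only [smul_eq_mul] using summable_smul (hC₀ φ 0) p
  simpa only [trigEval_apply] using
    hasDerivAt_tsum ((hasSum_abs p).summable.mul_right C) hterm hbound hsum y

lemma iteratedDeriv_trigEval (n m : ℕ) (φ : ℝ) (p : Ell1) :
    iteratedDeriv m (fun y => trigEval n φ y p) =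
      fun y => trigEval (n + m) (φ + m * (Real.pi / 2)) y p := by
  induction m with
  | zero => simp
  | succ m ih =>
    rw [iteratedDeriv_succ, ih]
    funext y
    rw [(hasDerivAt_trigEval _ _ y p).deriv]
    push_cast
    ring_nf

lemma contDiff_trigEval (n : ℕ) (φ : ℝ) (p : Ell1) :
    ContDiff ℝ ((⊤ : ℕ∞) : WithTop ℕ∞) fun y => trigEval n φ y p := by
  refine contDiff_of_differentiable_iteratedDeriv fun m _ => ?_
  rw [iteratedDeriv_trigEval]
  exact fun y => (hasDerivAt_trigEval _ _ y p).differentiableAt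

/-- The even function `∑ 2^{-|k|} p_k cos (k y)` encoded by `p`. -/
def evenPart (p : Ell1) (y : ℝ) : ℝ := trigEval 0 0 y p

/-- The odd function `∑ 2^{-|k|} p_k sin (k y)` encoded by `p`. -/
def oddPart (p : Ell1) (y : ℝ) : ℝ := trigEval 0 (-(Real.pi / 2)) y p

lemma cos_add_neg_pi_div_two (t : ℝ) : Real.cos (t + -(Real.pi / 2)) = Real.sin t := by
  rw [← sub_eq_add_neg, Real.cos_sub_pi_div_two]

lemma even_evenPart (p : Ell1) : Function.Even (evenPart p) := fun y => by
  simp [evenPart, trigEval_apply]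

lemma odd_oddPart (p : Ell1) : Function.Odd (oddPart p) := fun y => by
  simp [oddPart, trigEval_apply, cos_add_neg_pi_div_two, tsum_neg]

lemma periodic_trigEval (n : ℕ) (φ : ℝ) (p : Ell1) :
    Function.Periodic (fun y => trigEval n φ y p) (2 * Real.pi) := fun y => by
  simp only [trigEval_apply]
  refine tsum_congr fun k => ?_
  rw [show (k : ℝ) * (y + 2 * Real.pi) + φ = k * y + φ + k * (2 * Real.pi) by ring,
    Real.cos_add_int_mul_two_pi]

lemma isSmoothPeriodic_evenPart (p : Ell1) : IsSmoothPeriodic (evenPart p) :=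
  ⟨contDiff_trigEval _ _ _, periodic_trigEval _ _ _⟩

lemma isSmoothPeriodic_oddPart (p : Ell1) : IsSmoothPeriodic (oddPart p) :=
  ⟨contDiff_trigEval _ _ _, periodic_trigEval _ _ _⟩

/-! ### The nonlinearity and `D_μ` on coefficients. -/

/-- The encoding of the product of two encoded unit vectors. -/
def convVec (i j : ℤ) : Ell1 :=
  (weight i * weight j / 2) •
    ((weight (i - j))⁻¹ • (basisVec (i - j) + basisVec (-(i - j))) +
      (weight (i + j))⁻¹ • (basisVec (i + j) - basisVec (-(i + j))))

/-- Since `|i ± j| ≤ |i| + |j|`, dividing by the weight of `i ± j` costs no more than the two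
weights in front supply. -/
lemma norm_convVec_le (i j : ℤ) : ‖convVec i j‖ ≤ 2 := by
  have key : ∀ k : ℤ, k.natAbs ≤ i.natAbs + j.natAbs →
      weight i * weight j * (weight k)⁻¹ ≤ 1 := fun k hk => by
    rw [← div_eq_mul_inv, div_le_one (weight_pos k)]
    exact weight_mul_le hk
  have h₁ := key (i - j) (by omega)
  have h₂ := key (i + j) (by omega)
  have hp : ∀ k, ‖basisVec k + basisVec (-k)‖ ≤ 2 := fun k =>
    (norm_add_le _ _).trans (by simp only [norm_basisVec]; norm_num)
  have hm : ∀ k, ‖basisVec k - basisVec (-k)‖ ≤ 2 := fun k =>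
    (norm_sub_le _ _).trans (by simp only [norm_basisVec]; norm_num)
  have hi := weight_pos i
  have hj := weight_pos j
  have hs := weight_pos (i - j)
  have ha := weight_pos (i + j)
  have hw : 0 < weight i * weight j / 2 := by positivity
  calc ‖convVec i j‖ ≤ weight i * weight j / 2 *
        ((weight (i - j))⁻¹ * 2 + (weight (i + j))⁻¹ * 2) := by
        rw [convVec, norm_smul, Real.norm_of_nonneg hw.le]
        refine mul_le_mul_of_nonneg_left ((norm_add_le _ _).trans ?_) hw.le
        rw [norm_smul, norm_smul, Real.norm_of_nonneg (inv_pos.2 hs).le,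
          Real.norm_of_nonneg (inv_pos.2 ha).le]
        gcongr
        · exact hp _
        · exact hm _
    _ ≤ 2 := by linarith

/-- The bilinear map on `ℓ¹(ℤ)` that encodes multiplication of functions. -/
def conv : Ell1 →L[ℝ] Ell1 →L[ℝ] Ell1 :=
  lift (fun i => lift (convVec i) ⟨2, norm_convVec_le i⟩)
    ⟨2, fun i => opNorm_le _ fun j => by simpa using norm_convVec_le i j⟩

lemma conv_basisVec (i j : ℤ) : conv (basisVec i) (basisVec j) = convVec i j := by
  simp [conv]

lemma clm_ext₂ {F : Type*} [NormedAddCommGroup F] [NormedSpace ℝ F]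
    {S T : Ell1 →L[ℝ] Ell1 →L[ℝ] F}
    (h : ∀ i j, S (basisVec i) (basisVec j) = T (basisVec i) (basisVec j)) : S = T :=
  clm_ext fun i => clm_ext fun j => h i j

/-- Both sides are continuous and bilinear, so unit vectors suffice; there it is the addition
formula for `cos ((i - j) y)`, while the `i + j` component of `convVec` is purely odd. -/
lemma evenPart_conv (p q : Ell1) :
    evenPart (conv p q) = evenPart p * evenPart q + oddPart p * oddPart q := by
  funext y
  have : (ContinuousLinearMap.compL ℝ Ell1 Ell1 ℝ (trigEval 0 0 y)).comp conv =
      (ContinuousLinearMap.mul ℝ ℝ).bilinearComp (trigEval 0 0 y) (trigEval 0 0 y) +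
      (ContinuousLinearMap.mul ℝ ℝ).bilinearComp (trigEval 0 (-(Real.pi / 2)) y)
        (trigEval 0 (-(Real.pi / 2)) y) := by
    refine clm_ext₂ fun i j => ?_
    have h1 := (weight_pos (i - j)).ne'
    have h2 := (weight_pos (i + j)).ne'
    have e1 : Real.cos (((i - j : ℤ) : ℝ) * y) =
        Real.cos (i * y) * Real.cos (j * y) + Real.sin (i * y) * Real.sin (j * y) := by
      rw [← Real.cos_sub]; push_cast; ring_nf
    simp only [ContinuousLinearMap.comp_apply, ContinuousLinearMap.compL_apply, conv_basisVec,
      add_apply, ContinuousLinearMap.bilinearComp_apply,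
      ContinuousLinearMap.mul_apply', trigEval_basisVec, cos_add_neg_pi_div_two, convVec,
      map_smul, map_add, map_sub, weight_neg, smul_eq_mul, pow_zero, mul_one, add_zero,
      Int.cast_neg (R := ℝ), neg_mul, Real.cos_neg, e1]
    field_simp
    ring
  exact congrArg (fun T => T p q) this

lemma oddPart_conv (p q : Ell1) :
    oddPart (conv p q) = evenPart p * oddPart q + oddPart p * evenPart q := by
  funext y
  have : (ContinuousLinearMap.compL ℝ Ell1 Ell1 ℝ (trigEval 0 (-(Real.pi / 2)) y)).comp conv =
      (ContinuousLinearMap.mul ℝ ℝ).bilinearComp (trigEval 0 0 y)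
        (trigEval 0 (-(Real.pi / 2)) y) +
      (ContinuousLinearMap.mul ℝ ℝ).bilinearComp (trigEval 0 (-(Real.pi / 2)) y)
        (trigEval 0 0 y) := by
    refine clm_ext₂ fun i j => ?_
    have h1 := (weight_pos (i - j)).ne'
    have h2 := (weight_pos (i + j)).ne'
    have e1 : Real.sin (((i + j : ℤ) : ℝ) * y) =
        Real.sin (i * y) * Real.cos (j * y) + Real.cos (i * y) * Real.sin (j * y) := by
      rw [← Real.sin_add]; push_cast; ring_nf
    simp only [ContinuousLinearMap.comp_apply, ContinuousLinearMap.compL_apply, conv_basisVec,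
      add_apply, ContinuousLinearMap.bilinearComp_apply,
      ContinuousLinearMap.mul_apply', trigEval_basisVec, cos_add_neg_pi_div_two, convVec,
      map_smul, map_add, map_sub, weight_neg, smul_eq_mul, pow_zero, mul_one, add_zero,
      Int.cast_neg (R := ℝ), neg_mul, Real.sin_neg, e1]
    field_simp
    ring
  exact congrArg (fun T => T p q) this

/-- The operator `D_μ` on encoded profiles, for shifts of length `ω`. -/
def fullOp (μ ω : ℝ) : Ell1 →L[ℝ] Ell1 :=
  lift (fun k => (2 + μ + μ * Real.sin (k * ω)) • basisVec k -
      ((2 + μ) * Real.cos (k * ω)) • basisVec (-k))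
    ⟨|2 + μ| + |μ| + |2 + μ|, fun k => by
      refine (norm_sub_le _ _).trans ?_
      rw [norm_smul, norm_smul, norm_basisVec, norm_basisVec, mul_one, mul_one, Real.norm_eq_abs,
        Real.norm_eq_abs, abs_mul]
      refine add_le_add ((abs_add_le _ _).trans (add_le_add le_rfl ?_))
        (mul_le_of_le_one_right (abs_nonneg _) (Real.abs_cos_le_one _))
      rw [abs_mul]
      exact mul_le_of_le_one_right (abs_nonneg _) (Real.abs_sin_le_one _)⟩

@[simp] lemma fullOp_basisVec (μ ω : ℝ) (k : ℤ) :
    fullOp μ ω (basisVec k) = (2 + μ + μ * Real.sin (k * ω)) • basisVec k -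
      ((2 + μ) * Real.cos (k * ω)) • basisVec (-k) := lift_basisVec _ _ _

lemma fullOp_apply (μ ω : ℝ) (p : Ell1) (k : ℤ) :
    fullOp μ ω p k =
      (2 + μ + μ * Real.sin (k * ω)) * p k - (2 + μ) * Real.cos (k * ω) * p (-k) := by
  have : (coord k).comp (fullOp μ ω) = (2 + μ + μ * Real.sin (k * ω)) • coord k -
      ((2 + μ) * Real.cos (k * ω)) • coord (-k) := by
    refine clm_ext fun j => ?_
    simp only [ContinuousLinearMap.comp_apply, fullOp_basisVec, map_sub, map_smul,
      sub_apply, smul_apply, coord_apply, basisVec_apply,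
      smul_eq_mul]
    by_cases h1 : k = j <;> by_cases h2 : k = -j
    · simp [← h1, show -k = k by omega]
    · simp [← h1, show ¬ (-k = k) by omega, show ¬ (k = -k) by omega]
    · simp [h2, show ¬ (-j = j) by omega]
    · simp [h1, h2, show ¬ (-k = j) by omega]
  exact congrArg (fun T => T p) this

lemma evenPart_fullOp (μ ω : ℝ) (p : Ell1) (y : ℝ) :
    evenPart (fullOp μ ω p) y = 1 / 2 * ((2 + μ) * (2 * evenPart p y -
      (evenPart p (y + ω) + evenPart p (y - ω))) + μ * (oddPart p (y + ω) - oddPart p (y - ω))) := by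
  have : (trigEval 0 0 y).comp (fullOp μ ω) =
      (1 / 2 : ℝ) • ((2 + μ) • ((2 : ℝ) • trigEval 0 0 y -
        (trigEval 0 0 (y + ω) + trigEval 0 0 (y - ω))) +
        μ • (trigEval 0 (-(Real.pi / 2)) (y + ω) - trigEval 0 (-(Real.pi / 2)) (y - ω))) := by
    refine clm_ext fun k => ?_
    simp only [ContinuousLinearMap.comp_apply, fullOp_basisVec, map_sub, map_smul,
      sub_apply, smul_apply, add_apply,
      trigEval_basisVec, weight_neg, cos_add_neg_pi_div_two, smul_eq_mul, pow_zero, mul_one,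
      add_zero, Int.cast_neg (R := ℝ), neg_mul, Real.cos_neg]
    simp only [mul_add, mul_sub (k : ℝ), Real.cos_add, Real.cos_sub, Real.sin_add, Real.sin_sub]
    ring
  exact congrArg (fun T => T p) this

lemma oddPart_fullOp (μ ω : ℝ) (p : Ell1) (y : ℝ) :
    oddPart (fullOp μ ω p) y = 1 / 2 * (-(μ * (evenPart p (y + ω) - evenPart p (y - ω))) +
      (2 + μ) * (2 * oddPart p y + (oddPart p (y + ω) + oddPart p (y - ω)))) := by
  have : (trigEval 0 (-(Real.pi / 2)) y).comp (fullOp μ ω) =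
      (1 / 2 : ℝ) • (-(μ • (trigEval 0 0 (y + ω) - trigEval 0 0 (y - ω))) +
        (2 + μ) • ((2 : ℝ) • trigEval 0 (-(Real.pi / 2)) y +
        (trigEval 0 (-(Real.pi / 2)) (y + ω) + trigEval 0 (-(Real.pi / 2)) (y - ω)))) := by
    refine clm_ext fun k => ?_
    simp only [ContinuousLinearMap.comp_apply, fullOp_basisVec, map_sub, map_smul,
      sub_apply, smul_apply, add_apply,
      neg_apply,
      trigEval_basisVec, weight_neg, cos_add_neg_pi_div_two, smul_eq_mul, pow_zero, mul_one,
      add_zero, Int.cast_neg (R := ℝ), neg_mul, Real.sin_neg]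
    simp only [mul_add, mul_sub (k : ℝ), Real.cos_add, Real.cos_sub, Real.sin_add, Real.sin_sub]
    ring
  exact congrArg (fun T => T p) this

end Ell1

/-! ### Two analytic tools. -/

/-- Implicit function theorem for a `C¹` map on a product, in terms of the partial derivative. -/
lemma exists_lipschitz_implicit {E₁ E₂ F : Type*} [NormedAddCommGroup E₁] [NormedSpace ℝ E₁]
    [CompleteSpace E₁] [NormedAddCommGroup E₂] [NormedSpace ℝ E₂] [CompleteSpace E₂]
    [NormedAddCommGroup F] [NormedSpace ℝ F] [CompleteSpace F] {f : E₁ × E₂ → F} {x₀ : E₁} {y₀ : E₂}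
    (hf : ContDiffAt ℝ 1 f (x₀, y₀)) (e : E₂ ≃L[ℝ] F)
    (he : HasFDerivAt (fun y => f (x₀, y)) (e : E₂ →L[ℝ] F) y₀) :
    ∃ ψ : E₁ → E₂, (∃ K, ∃ s ∈ nhds x₀, LipschitzOnWith K ψ s) ∧
      Filter.Tendsto ψ (nhds x₀) (nhds y₀) ∧ ∀ᶠ x in nhds x₀, f (x, ψ x) = f (x₀, y₀) := by
  have hs := hf.hasStrictFDerivAt one_ne_zero
  have hinr : HasFDerivAt (fun y : E₂ => (x₀, y)) (.inr ℝ E₁ E₂) y₀ :=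
    hasFDerivAt_prodMk_right x₀ y₀
  have heq : (fderiv ℝ f (x₀, y₀)) ∘L .inr ℝ E₁ E₂ = e :=
    (hs.hasFDerivAt.comp y₀ hinr).unique he
  have hinv : ((fderiv ℝ f (x₀, y₀)) ∘L .inr ℝ E₁ E₂).IsInvertible := ⟨e, heq.symm⟩
  exact ⟨hs.implicitFunctionOfProdDomain hinv,
    (hs.hasStrictFDerivAt_implicitFunctionOfProdDomain hinv).exists_lipschitzOnWith,
    hs.tendsto_implicitFunctionOfProdDomain hinv,
    hs.eventually_apply_implicitFunctionOfProdDomain hinv⟩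

/-- Mean value inequality for `cos t + t sin a`, whose derivative is at most `|b - a|` between `a`
and `b`. -/
lemma abs_cos_sub_add_mul_sin_le (a b : ℝ) :
    |Real.cos b - Real.cos a + (b - a) * Real.sin a| ≤ |b - a| ^ 2 := by
  have hd : ∀ t ∈ Set.uIcc a b, HasDerivWithinAt (fun t => Real.cos t + t * Real.sin a)
      (-Real.sin t + Real.sin a) (Set.uIcc a b) t := fun t _ => by
    refine HasDerivAt.hasDerivWithinAt ?_
    simpa using (Real.hasDerivAt_cos t).fun_add ((hasDerivAt_id t).mul_const (Real.sin a))
  have hb : ∀ t ∈ Set.uIcc a b, ‖-Real.sin t + Real.sin a‖ ≤ |b - a| := fun t ht => by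
    have := Real.lipschitzWith_sin.dist_le_mul a t
    rw [Real.dist_eq, Real.dist_eq, NNReal.coe_one, one_mul] at this
    rw [Real.norm_eq_abs, neg_add_eq_sub]
    exact this.trans (by rw [abs_sub_comm]; exact Set.abs_sub_left_of_mem_uIcc ht)
  have := (convex_uIcc a b).norm_image_sub_le_of_norm_hasDerivWithin_le hd hb
    Set.left_mem_uIcc Set.right_mem_uIcc
  rw [Real.norm_eq_abs, Real.norm_eq_abs] at this
  rw [pow_two]
  convert this using 2
  ring

/-! ### Smoothed multipliers, differentiable in the frequency. -/

namespace Ell1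

/-- The Fourier multiplier `k⁻²`, cut off to the modes `|k| ≥ 2`. -/
def cutoff (k : ℤ) : ℝ := if 2 ≤ k.natAbs then ((k : ℝ) ^ 2)⁻¹ else 0

lemma cutoff_nonneg (k : ℤ) : 0 ≤ cutoff k := by
  unfold cutoff; split_ifs <;> positivity

lemma cutoff_neg (k : ℤ) : cutoff (-k) = cutoff k := by
  simp [cutoff]

lemma cutoff_mul_sq_le (k : ℤ) : cutoff k * (k : ℝ) ^ 2 ≤ 1 := by
  unfold cutoff; split_ifs
  · exact inv_mul_le_one
  · simp

lemma cutoff_le (k : ℤ) : cutoff k ≤ 1 / 4 := by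
  unfold cutoff; split_ifs with h
  · rw [one_div]
    refine inv_anti₀ (by norm_num) ?_
    have : (2 : ℝ) ≤ |(k : ℝ)| := by
      rw [← Int.cast_abs, Int.abs_eq_natAbs]
      exact_mod_cast h
    nlinarith [sq_abs (k : ℝ)]
  · norm_num

lemma cutoff_mul_abs_le (k : ℤ) : cutoff k * |(k : ℝ)| ≤ 1 := by
  have h1 := cutoff_mul_sq_le k
  have h2 := cutoff_le k
  have h0 := cutoff_nonneg k
  nlinarith [sq_abs (k : ℝ), sq_nonneg (|(k : ℝ)| - 1), abs_nonneg (k : ℝ)]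

lemma norm_cutoff_smul_le (s φ ω : ℝ) (k j : ℤ) (h : cutoff k * |s| ≤ 1) :
    ‖(cutoff k * s * Real.cos (k * ω + φ)) • basisVec j‖ ≤ 1 := by
  rw [norm_smul, norm_basisVec, mul_one, Real.norm_eq_abs, abs_mul, abs_mul,
    abs_of_nonneg (cutoff_nonneg k)]
  exact mul_le_one₀ h (abs_nonneg _) (Real.abs_cos_le_one _)

/-- The operator `e_k ↦ cutoff k * cos (k ω + φ) • e_{σ k}`. -/
def cutMult (σ : ℤ) (φ ω : ℝ) : Ell1 →L[ℝ] Ell1 :=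
  lift (fun k => (cutoff k * 1 * Real.cos (k * ω + φ)) • basisVec (σ * k))
    ⟨1, fun k => norm_cutoff_smul_le 1 φ ω k _ (by
      rw [abs_one, mul_one]; exact (cutoff_le k).trans (by norm_num))⟩

/-- The derivative of `cutMult` with respect to the frequency. -/
def cutMultDeriv (σ : ℤ) (φ ω : ℝ) : Ell1 →L[ℝ] Ell1 :=
  lift (fun k => (cutoff k * k * Real.cos (k * ω + (φ + Real.pi / 2))) • basisVec (σ * k))
    ⟨1, fun k => norm_cutoff_smul_le k _ ω k _ (cutoff_mul_abs_le k)⟩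

@[simp] lemma cutMult_basisVec (σ : ℤ) (φ ω : ℝ) (k : ℤ) : cutMult σ φ ω (basisVec k) =
    (cutoff k * Real.cos (k * ω + φ)) • basisVec (σ * k) := by
  simp [cutMult]

@[simp] lemma cutMultDeriv_basisVec (σ : ℤ) (φ ω : ℝ) (k : ℤ) : cutMultDeriv σ φ ω (basisVec k) =
    (cutoff k * k * Real.cos (k * ω + (φ + Real.pi / 2))) • basisVec (σ * k) := by
  simp [cutMultDeriv]

lemma norm_cutMult_le (σ : ℤ) (φ ω : ℝ) : ‖cutMult σ φ ω‖ ≤ 1 / 4 := by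
  refine opNorm_le _ fun k => ?_
  rw [cutMult_basisVec, norm_smul, norm_basisVec, mul_one, Real.norm_eq_abs, abs_mul,
    abs_of_nonneg (cutoff_nonneg k)]
  exact (mul_le_of_le_one_right (cutoff_nonneg k) (Real.abs_cos_le_one _)).trans (cutoff_le k)

/-- The Taylor remainder on mode `k` is at most `k²|ω' - ω|²`; the cutoff multiplier pays for `k²`,
which makes the estimate uniform in `k`. -/
lemma hasDerivAt_cutMult (σ : ℤ) (φ ω : ℝ) :
    HasDerivAt (cutMult σ φ) (cutMultDeriv σ φ ω) ω := by
  have key : ∀ ω', ‖cutMult σ φ ω' - cutMult σ φ ω - (ω' - ω) • cutMultDeriv σ φ ω‖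
      ≤ 1 * ‖ω' - ω‖ ^ 2 := by
    intro ω'
    refine opNorm_le _ fun k => ?_
    simp only [sub_apply, smul_apply, cutMult_basisVec, cutMultDeriv_basisVec, smul_smul,
      ← sub_smul]
    rw [norm_smul, norm_basisVec, mul_one, ← add_assoc, Real.cos_add_pi_div_two]
    have h := abs_cos_sub_add_mul_sin_le (k * ω + φ) (k * ω' + φ)
    have he : (k * ω' + φ - (k * ω + φ) : ℝ) = k * (ω' - ω) := by ring
    rw [he, abs_mul, mul_pow, sq_abs (k : ℝ)] at h
    calc _ = cutoff k * |Real.cos (k * ω' + φ) - Real.cos (k * ω + φ) +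
          k * (ω' - ω) * Real.sin (k * ω + φ)| := by
          rw [← abs_of_nonneg (cutoff_nonneg k), ← abs_mul, Real.norm_eq_abs,
            abs_of_nonneg (cutoff_nonneg k)]
          congr 1
          ring
      _ ≤ cutoff k * ((k : ℝ) ^ 2 * |ω' - ω| ^ 2) :=
          mul_le_mul_of_nonneg_left h (cutoff_nonneg k)
      _ = cutoff k * (k : ℝ) ^ 2 * |ω' - ω| ^ 2 := by ring
      _ ≤ 1 * ‖ω' - ω‖ ^ 2 :=
          mul_le_mul_of_nonneg_right (cutoff_mul_sq_le k) (by positivity)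
  rw [hasDerivAt_iff_isLittleO]
  refine (Asymptotics.IsBigO.of_bound 1 (g := fun ω' => ‖ω' - ω‖ ^ 2)
    (Filter.Eventually.of_forall fun ω' => ?_)).trans_isLittleO ?_
  · simpa using key ω'
  · exact Asymptotics.isLittleO_pow_sub_sub ω one_lt_two

lemma continuous_cutMultDeriv (σ : ℤ) (φ : ℝ) : Continuous (cutMultDeriv σ φ) := by
  refine LipschitzWith.continuous (K := 1) (LipschitzWith.of_dist_le_mul fun ω ω' => ?_)
  rw [dist_eq_norm, Real.dist_eq]
  refine opNorm_le _ fun k => ?_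
  rw [sub_apply, cutMultDeriv_basisVec, cutMultDeriv_basisVec, ← sub_smul, norm_smul,
    norm_basisVec, mul_one, ← mul_sub, Real.norm_eq_abs, abs_mul, abs_mul,
    abs_of_nonneg (cutoff_nonneg k)]
  have h := Real.lipschitzWith_cos.dist_le_mul (k * ω + (φ + Real.pi / 2))
    (k * ω' + (φ + Real.pi / 2))
  rw [Real.dist_eq, Real.dist_eq, add_sub_add_right_eq_sub, ← mul_sub, abs_mul, NNReal.coe_one,
    one_mul] at h
  calc _ ≤ cutoff k * |(k : ℝ)| * (|(k : ℝ)| * |ω - ω'|) :=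
        mul_le_mul_of_nonneg_left h (mul_nonneg (cutoff_nonneg k) (abs_nonneg _))
    _ = cutoff k * (k : ℝ) ^ 2 * |ω - ω'| := by rw [← sq_abs]; ring
    _ ≤ _ := by
        rw [NNReal.coe_one]
        exact mul_le_mul_of_nonneg_right (cutoff_mul_sq_le k) (abs_nonneg _)

@[fun_prop]
lemma contDiff_cutMult (σ : ℤ) (φ : ℝ) : ContDiff ℝ 1 (cutMult σ φ) := by
  rw [contDiff_one_iff_deriv]
  refine ⟨fun ω => (hasDerivAt_cutMult σ φ ω).differentiableAt, ?_⟩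
  rw [show deriv (cutMult σ φ) = cutMultDeriv σ φ from
    funext fun ω => (hasDerivAt_cutMult σ φ ω).deriv]
  exact continuous_cutMultDeriv σ φ

/-- The operator `D_μ ∂⁻²` (up to sign) on the modes `|k| ≥ 2`. -/
def cutOp (μ ω : ℝ) : Ell1 →L[ℝ] Ell1 :=
  (2 + μ) • cutMult 1 0 0 + μ • cutMult 1 (-(Real.pi / 2)) ω - (2 + μ) • cutMult (-1) 0 ω

/-- The bound is `3/4 + 1/4 + 3/4`. What matters is that it stays below 2, a lower bound for `c²ω²`
along the branch. -/
lemma norm_cutOp_le (μ ω : ℝ) (hμ : |μ| ≤ 1) : ‖cutOp μ ω‖ ≤ 7 / 4 := by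
  have h2 : |2 + μ| ≤ 3 := (abs_add_le _ _).trans (by norm_num; linarith)
  have hb : ∀ (t : ℝ) σ φ ω, ‖t • cutMult σ φ ω‖ ≤ |t| * (1 / 4) := fun t σ φ ω => by
    rw [norm_smul, Real.norm_eq_abs]
    exact mul_le_mul_of_nonneg_left (norm_cutMult_le _ _ _) (abs_nonneg _)
  refine (norm_sub_le _ _).trans ((add_le_add (norm_add_le _ _) le_rfl).trans ?_)
  linarith [hb (2 + μ) 1 0 0, hb μ 1 (-(Real.pi / 2)) ω, hb (2 + μ) (-1) 0 ω]

lemma cutOp_apply (μ ω : ℝ) (p : Ell1) (k : ℤ) : cutOp μ ω p k = cutoff k * fullOp μ ω p k := by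
  have : (coord k).comp (cutOp μ ω) = cutoff k • (coord k).comp (fullOp μ ω) := by
    refine clm_ext fun j => ?_
    simp only [ContinuousLinearMap.comp_apply, cutOp, sub_apply, add_apply, smul_apply,
      cutMult_basisVec, fullOp_basisVec, map_sub, map_add, map_smul, coord_apply, basisVec_apply,
      smul_eq_mul, cos_add_neg_pi_div_two, one_mul, neg_mul, mul_zero, add_zero, Real.cos_zero]
    by_cases h1 : k = j
    · subst h1
      split_ifs <;> ring
    · by_cases h2 : k = -j
      · rw [h2, cutoff_neg]
        split_ifs <;> ring
      · simp [h1, h2]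
  exact congrArg (fun T => T p) this

/-! ### Bifurcation equations and their local solution branch. -/

/-- The vector encoding `(α cos y, sin y)` plus the remainder `p`. -/
def profileVec (α : ℝ) (p : Ell1) : Ell1 :=
  (α + 1) • basisVec 1 + (α - 1) • basisVec (-1) + p

/-- The vector encoding the quadratic nonlinearity. -/
def quadVec (α : ℝ) (p : Ell1) : Ell1 := conv (profileVec α p) (profileVec α p)

/-- The first cosine coefficient of the nonlinearity. -/
def quadCos (α : ℝ) (p : Ell1) : ℝ := (coord 1 (quadVec α p) + coord (-1) (quadVec α p)) / 2

/-- The first sine coefficient of the nonlinearity. -/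
def quadSin (α : ℝ) (p : Ell1) : ℝ := (coord 1 (quadVec α p) - coord (-1) (quadVec α p)) / 2

/-- The bifurcation equations for the sine mode, the cosine mode and the modes `|k| ≥ 2`, as a
function of the parameters `(μ, a)` and the unknowns `(ω, α, p)`. -/
def bifurcationMap (c : ℝ) (x : (ℝ × ℝ) × (ℝ × ℝ × Ell1)) : ℝ × ℝ × Ell1 :=
  (c ^ 2 * x.2.1 ^ 2
      - x.1.1 * Real.sin x.2.1 * (x.2.2.1 + x.1.2 * quadCos x.2.2.1 x.2.2.2)
      - (2 + x.1.1) * (1 + Real.cos x.2.1) * (1 + x.1.2 * quadSin x.2.2.1 x.2.2.2),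
   c ^ 2 * x.2.1 ^ 2 * x.2.2.1
      - (2 + x.1.1) * (1 - Real.cos x.2.1) * (x.2.2.1 + x.1.2 * quadCos x.2.2.1 x.2.2.2)
      - x.1.1 * Real.sin x.2.1 * (1 + x.1.2 * quadSin x.2.2.1 x.2.2.2),
   x.2.2.2 - (c ^ 2 * x.2.1 ^ 2)⁻¹ •
      cutOp x.1.1 x.2.1 (x.2.2.2 + x.1.2 • quadVec x.2.2.1 x.2.2.2))

lemma contDiffAt_bifurcationMap (c : ℝ) (x : (ℝ × ℝ) × (ℝ × ℝ × Ell1))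
    (h : c ^ 2 * x.2.1 ^ 2 ≠ 0) : ContDiffAt ℝ 1 (bifurcationMap c) x := by
  unfold bifurcationMap quadCos quadSin quadVec profileVec cutOp
  fun_prop (disch := assumption)

/-- The partial derivative of the bifurcation map with respect to the unknowns. -/
def bifurcationEquiv (A B : ℝˣ) (K : Ell1 →L[ℝ] Ell1) (hK : ‖K‖ < 1) :
    (ℝ × ℝ × Ell1) ≃L[ℝ] (ℝ × ℝ × Ell1) :=
  (ContinuousLinearEquiv.unitsEquivAut ℝ A).prodCongr
    ((ContinuousLinearEquiv.unitsEquivAut ℝ B).prodCongr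
      (ContinuousLinearEquiv.unitsEquiv ℝ Ell1 (Units.oneSub K hK)))

/-- At `μ = a = 0` the nonlinearity disappears and the equations decouple; the `ω`-derivatives of
the second and third components vanish because `α = 0` and `p = 0` at the base point. -/
lemma hasFDerivAt_bifurcationMap (c ω₀ : ℝ) (h : c ^ 2 * ω₀ ^ 2 ≠ 0) (A B : ℝˣ)
    (hA : (A : ℝ) = 2 * c ^ 2 * ω₀ + 2 * Real.sin ω₀)
    (hB : (B : ℝ) = c ^ 2 * ω₀ ^ 2 - 2 * (1 - Real.cos ω₀))
    (hK : ‖(c ^ 2 * ω₀ ^ 2)⁻¹ • cutOp 0 ω₀‖ < 1) :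
    HasFDerivAt (fun y => bifurcationMap c ((0, 0), y))
      (bifurcationEquiv A B _ hK : (ℝ × ℝ × Ell1) →L[ℝ] (ℝ × ℝ × Ell1)) (ω₀, 0, 0) := by
  have hω : HasFDerivAt (fun y : ℝ × ℝ × Ell1 => y.1) (.fst ℝ ℝ (ℝ × Ell1)) (ω₀, 0, 0) :=
    hasFDerivAt_fst
  have hα : HasFDerivAt (fun y : ℝ × ℝ × Ell1 => y.2.1)
      ((ContinuousLinearMap.fst ℝ ℝ Ell1).comp (.snd ℝ ℝ (ℝ × Ell1))) (ω₀, 0, 0) :=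
    hasFDerivAt_fst.comp _ hasFDerivAt_snd
  have hp : HasFDerivAt (fun y : ℝ × ℝ × Ell1 => y.2.2)
      ((ContinuousLinearMap.snd ℝ ℝ Ell1).comp (.snd ℝ ℝ (ℝ × Ell1))) (ω₀, 0, 0) :=
    hasFDerivAt_snd.comp _ hasFDerivAt_snd
  have hg₁ : HasDerivAt (fun ω => c ^ 2 * ω ^ 2 - 2 * (1 + Real.cos ω)) (A : ℝ) ω₀ := by
    have := (((hasDerivAt_id ω₀).fun_pow 2).const_mul (c ^ 2)).fun_sub
      (((Real.hasDerivAt_cos ω₀).const_add 1).const_mul 2)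
    refine this.congr_deriv ?_
    rw [hA]; simp; ring
  have hg₂ : HasDerivAt (fun ω => c ^ 2 * ω ^ 2 - 2 * (1 - Real.cos ω))
      (2 * c ^ 2 * ω₀ - 2 * Real.sin ω₀) ω₀ := by
    have := (((hasDerivAt_id ω₀).fun_pow 2).const_mul (c ^ 2)).fun_sub
      (((Real.hasDerivAt_cos ω₀).const_sub 1).const_mul 2)
    refine this.congr_deriv ?_
    simp; ring
  have hcut : DifferentiableAt ℝ (fun ω => (c ^ 2 * ω ^ 2)⁻¹ • cutOp 0 ω) ω₀ := by
    have : ContDiffAt ℝ 1 (fun ω => (c ^ 2 * ω ^ 2)⁻¹ • cutOp 0 ω) ω₀ := by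
      unfold cutOp
      fun_prop (disch := assumption)
    exact this.differentiableAt one_ne_zero
  have h1 := hg₁.comp_hasFDerivAt (ω₀, 0, 0) hω
  have h2 := (hg₂.comp_hasFDerivAt (ω₀, 0, 0) hω).mul hα
  have h3 := hp.sub ((hcut.hasFDerivAt.comp (ω₀, 0, 0) hω).clm_apply hp)
  refine ((h1.prodMk (h2.prodMk h3)).congr_of_eventuallyEq
    (Filter.Eventually.of_forall fun y => ?_)).congr_fderiv ?_
  · simp only [bifurcationMap, Function.comp_apply, Pi.mul_apply, Pi.sub_apply, smul_apply,
      zero_mul, zero_smul, add_zero, mul_one, sub_zero]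
    refine Prod.ext rfl (Prod.ext ?_ rfl)
    simp only
    ring
  · refine ContinuousLinearMap.ext fun y => ?_
    refine Prod.ext ?_ (Prod.ext ?_ ?_)
    · simp [bifurcationEquiv, mul_comm]
    · simp [bifurcationEquiv, hB, mul_comm]
    · simp [bifurcationEquiv]

/-- The local branch of solutions of the bifurcation equations. -/
lemma exists_branch {c ω₀ : ℝ} (hω₀ : 0 < ω₀) (hcos : 0 < Real.cos ω₀) (hsin : 0 < Real.sin ω₀)
    (h : c ^ 2 * ω₀ ^ 2 = 2 + 2 * Real.cos ω₀) :
    ∃ ψ : ℝ × ℝ → ℝ × ℝ × Ell1, (∃ K, ∃ s ∈ nhds (0, 0), LipschitzOnWith K ψ s) ∧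
      Filter.Tendsto ψ (nhds (0, 0)) (nhds (ω₀, 0, 0)) ∧
      ∀ᶠ x in nhds (0, 0), bifurcationMap c (x, ψ x) = 0 := by
  have hpos : 2 < c ^ 2 * ω₀ ^ 2 := by linarith
  have hne : c ^ 2 * ω₀ ^ 2 ≠ 0 := by linarith
  have hA : 2 * c ^ 2 * ω₀ + 2 * Real.sin ω₀ ≠ 0 := by positivity
  -- By the dispersion relation this number equals `4 cos ω₀`.
  have hB : c ^ 2 * ω₀ ^ 2 - 2 * (1 - Real.cos ω₀) ≠ 0 := by rw [h]; linarith
  have hK : ‖(c ^ 2 * ω₀ ^ 2)⁻¹ • cutOp 0 ω₀‖ < 1 := by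
    rw [norm_smul, norm_inv, Real.norm_of_nonneg (by linarith), inv_mul_lt_one₀ (by linarith)]
    exact (norm_cutOp_le 0 ω₀ (by simp)).trans_lt (by linarith)
  have h0 : bifurcationMap c ((0, 0), (ω₀, 0, 0)) = 0 := by
    refine Prod.ext ?_ (Prod.ext ?_ ?_)
    · simp [bifurcationMap]; linarith
    · simp [bifurcationMap]
    · simp [bifurcationMap]
  have := exists_lipschitz_implicit (contDiffAt_bifurcationMap c ((0, 0), (ω₀, 0, 0)) hne)
    (bifurcationEquiv (Units.mk0 _ hA) (Units.mk0 _ hB) _ hK)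
    (hasFDerivAt_bifurcationMap c ω₀ hne _ _ rfl rfl hK)
  rwa [h0] at this

end Ell1

/-! ### The dispersion relation. -/

lemma abs_cos_sub_cos_le_sq_sub_sq {x y : ℝ} (hx : 0 ≤ x) (hxy : x ≤ y) :
    |Real.cos y - Real.cos x| ≤ (y ^ 2 - x ^ 2) / 2 := by
  have h1 : |Real.sin ((y + x) / 2)| ≤ (y + x) / 2 :=
    (Real.abs_sin_le_abs).trans_eq (abs_of_nonneg (by linarith))
  have h2 : |Real.sin ((y - x) / 2)| ≤ (y - x) / 2 :=
    (Real.abs_sin_le_abs).trans_eq (abs_of_nonneg (by linarith))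
  rw [Real.cos_sub_cos, abs_mul, abs_mul, abs_neg, abs_two]
  calc 2 * |Real.sin ((y + x) / 2)| * |Real.sin ((y - x) / 2)|
      ≤ 2 * ((y + x) / 2) * ((y - x) / 2) := by
        gcongr
        linarith
    _ = _ := by ring

/-- Let `s`, `t` be the square roots at `x`, `y` and `r = √(1+μ)`. Then `t² - s² = 4r²(cos² y - cos²
x)`; dividing by `t + s ≥ 2r(|cos x| + |cos y|)` gives `t - s ≤ 2r|cos y - cos x|`. -/
lemma lambdaPlus_sub_le {μ x y : ℝ} (hμ : 0 ≤ 1 + μ) (hx : 0 ≤ x) (hxy : x ≤ y) :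
    lambdaPlus μ y - lambdaPlus μ x ≤ Real.sqrt (1 + μ) * (y ^ 2 - x ^ 2) := by
  set r := Real.sqrt (1 + μ) with hr
  have hr0 : 0 ≤ r := Real.sqrt_nonneg _
  have hr2 : r ^ 2 = 1 + μ := Real.sq_sqrt hμ
  have hnn : ∀ K, 0 ≤ μ ^ 2 + 4 * (1 + μ) * Real.cos K ^ 2 := fun K => by positivity
  have hge : ∀ K, 2 * r * |Real.cos K| ≤ Real.sqrt (μ ^ 2 + 4 * (1 + μ) * Real.cos K ^ 2) :=
    fun K => Real.le_sqrt_of_sq_le (by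
      rw [mul_pow, mul_pow, hr2, sq_abs]; nlinarith [sq_nonneg μ])
  have hcos := abs_cos_sub_cos_le_sq_sub_sq hx hxy
  have hsx := Real.sq_sqrt (hnn x)
  have hsy := Real.sq_sqrt (hnn y)
  have hx' := hge x
  have hy' := hge y
  unfold lambdaPlus
  set s := Real.sqrt (μ ^ 2 + 4 * (1 + μ) * Real.cos x ^ 2)
  set t := Real.sqrt (μ ^ 2 + 4 * (1 + μ) * Real.cos y ^ 2)
  have hs0 : 0 ≤ s := Real.sqrt_nonneg _
  have ht0 : 0 ≤ t := Real.sqrt_nonneg _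
  have hyx : 0 ≤ y ^ 2 - x ^ 2 := by nlinarith
  rcases le_or_gt t s with hts | hts
  · have := mul_nonneg hr0 hyx
    linarith
  · have hsum : 0 < t + s := by linarith
    have hprod : (t - s) * (t + s) ≤ 2 * r * |Real.cos y - Real.cos x| * (t + s) := by
      calc (t - s) * (t + s) = 4 * r ^ 2 * ((Real.cos y - Real.cos x) *
            (Real.cos y + Real.cos x)) := by rw [hr2]; linear_combination hsy - hsx
        _ ≤ 4 * r ^ 2 * (|Real.cos y - Real.cos x| * (|Real.cos y| + |Real.cos x|)) := by
            refine mul_le_mul_of_nonneg_left ((le_abs_self _).trans ?_) (by positivity)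
            rw [abs_mul]
            exact mul_le_mul_of_nonneg_left (abs_add_le _ _) (abs_nonneg _)
        _ = 2 * r * |Real.cos y - Real.cos x| *
            (2 * r * |Real.cos y| + 2 * r * |Real.cos x|) := by ring
        _ ≤ _ := mul_le_mul_of_nonneg_left (add_le_add hy' hx') (by positivity)
    have h1 := le_of_mul_le_mul_right hprod hsum
    have h2 : r * |Real.cos y - Real.cos x| ≤ r * ((y ^ 2 - x ^ 2) / 2) :=
      mul_le_mul_of_nonneg_left hcos hr0
    linarith

/-- Two roots would force `c²(y² - x²) ≤ √(1+μ)(y² - x²)`, whereas `√(1+μ) < c²`. -/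
lemma isCriticalFrequency_unique {c μ x y : ℝ} (hμ : 0 ≤ 1 + μ) (hc : 1 + μ < c ^ 4)
    (hx : IsCriticalFrequency c μ x) (hy : IsCriticalFrequency c μ y) : x = y := by
  wlog hxy : x ≤ y generalizing x y
  · exact (this hy hx (le_of_not_ge hxy)).symm
  by_contra hne
  have hlt : x < y := lt_of_le_of_ne hxy hne
  have h := lambdaPlus_sub_le hμ hx.1.le hxy
  rw [← hx.2, ← hy.2] at h
  have hsq : 0 < y ^ 2 - x ^ 2 := by nlinarith [hx.1]
  have hr : Real.sqrt (1 + μ) < c ^ 2 := by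
    rw [Real.sqrt_lt' (by nlinarith [sq_nonneg c, Real.sqrt_nonneg (1 + μ)])]
    linarith [show (c ^ 2) ^ 2 = c ^ 4 by ring]
  nlinarith

lemma exists_isCriticalFrequency {c μ : ℝ} (hc : 1 < c ^ 2) (hμ : |μ| ≤ 1 / 2) :
    ∃ ω, IsCriticalFrequency c μ ω := by
  obtain ⟨h1, h2⟩ := abs_le.1 hμ
  have hcont : Continuous fun K => c ^ 2 * K ^ 2 - lambdaPlus μ K := by
    unfold lambdaPlus; fun_prop
  have h0 : c ^ 2 * (0 : ℝ) ^ 2 - lambdaPlus μ 0 < 0 := by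
    have := Real.sqrt_nonneg (μ ^ 2 + 4 * (1 + μ) * Real.cos 0 ^ 2)
    unfold lambdaPlus
    linarith
  have h3 : 0 ≤ c ^ 2 * (3 : ℝ) ^ 2 - lambdaPlus μ 3 := by
    have : Real.sqrt (μ ^ 2 + 4 * (1 + μ) * Real.cos 3 ^ 2) ≤ 3 := by
      rw [Real.sqrt_le_left (by norm_num)]
      nlinarith [Real.cos_sq_le_one 3, sq_nonneg (Real.cos 3)]
    unfold lambdaPlus
    linarith
  obtain ⟨ω, hω, hz⟩ := intermediate_value_Icc (by norm_num : (0 : ℝ) ≤ 3) hcont.continuousOn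
    ⟨h0.le, h3⟩
  refine ⟨ω, lt_of_le_of_ne hω.1 ?_, by simpa [sub_eq_zero] using hz⟩
  rintro rfl
  exact h0.ne hz

lemma exists_isFrequencyThreshold {c : ℝ} (hc : 1 < c ^ 2) :
    ∃ μω, IsFrequencyThreshold c μω := by
  have hc4 : 1 < c ^ 4 := by nlinarith [show c ^ 4 = c ^ 2 * c ^ 2 by ring]
  -- The first bound serves existence, the second keeps `1 + μ < c⁴` for uniqueness.
  refine ⟨min (1 / 2) ((c ^ 4 - 1) / 2), lt_min (by norm_num) (by linarith), fun μ hμ => ?_⟩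
  have h1 := hμ.trans (min_le_left _ _)
  have h2 := (le_abs_self _).trans (hμ.trans (min_le_right _ _))
  obtain ⟨ω, hω⟩ := exists_isCriticalFrequency hc h1
  exact ⟨ω, hω, fun ω' hω' => isCriticalFrequency_unique (by linarith [(abs_le.1 h1).1])
    (by linarith) hω' hω⟩

lemma criticalFrequency_eq {c μ ω : ℝ} (h : ∃! ω, IsCriticalFrequency c μ ω)
    (hω : IsCriticalFrequency c μ ω) : criticalFrequency c μ = ω := by
  have : {ω : ℝ | IsCriticalFrequency c μ ω} = {ω} := by
    ext x
    exact ⟨fun hx => h.unique hx hω, fun hx => by rw [Set.mem_singleton_iff.1 hx]; exact hω⟩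
  rw [criticalFrequency, this, csInf_singleton]

/-- For equal masses the critical frequency lies in the first quadrant. -/
lemma exists_monatomic_frequency {c : ℝ} (hc : 1 < c ^ 2) :
    ∃ ω, 0 < ω ∧ 0 < Real.cos ω ∧ 0 < Real.sin ω ∧ c ^ 2 * ω ^ 2 = 2 + 2 * Real.cos ω := by
  obtain ⟨ω, hpos, h⟩ := exists_isCriticalFrequency hc (μ := 0) (by norm_num)
  have hsq : 0 < ω ^ 2 := by positivity
  have hl : lambdaPlus 0 ω = 2 + 2 * |Real.cos ω| := by
    rw [lambdaPlus, show (0 : ℝ) ^ 2 + 4 * (1 + 0) * Real.cos ω ^ 2 = (2 * Real.cos ω) ^ 2 by ring,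
      Real.sqrt_sq_eq_abs, abs_mul, abs_two]
    ring
  rw [hl] at h
  have hcos : 0 < Real.cos ω := by
    by_contra hle
    rw [abs_of_nonpos (not_lt.1 hle)] at h
    -- If `cos ω ≤ 0`, then `c²ω² = 2 - 2 cos ω ≤ ω²`, contradicting `c² > 1`.
    nlinarith [Real.one_sub_sq_div_two_le_cos (x := ω)]
  have hlt : ω < 2 := by
    nlinarith [Real.abs_cos_le_one ω]
  exact ⟨ω, hpos, hcos, Real.sin_pos_of_pos_of_lt_pi hpos (hlt.trans (by linarith [Real.pi_gt_three])),
    by rw [h, abs_of_pos hcos]⟩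

/-! ### From zeros of the bifurcation map to traveling waves. -/

namespace Ell1

/-- At zero amplitude the bifurcation equations reduce to the dispersion relation. -/
lemma bifurcationMap_zero_amplitude {c μ ω α : ℝ} {p : Ell1}
    (h : bifurcationMap c ((μ, 0), (ω, α, p)) = 0) (hμ : |μ| ≤ 1) (hω : 0 < ω)
    (h2 : 2 < c ^ 2 * ω ^ 2) (hμ2 : 2 + μ < c ^ 2 * ω ^ 2)
    (hD : c ^ 2 * ω ^ 2 - (2 + μ) * (1 - Real.cos ω) ≠ 0) :
    p = 0 ∧ IsCriticalFrequency c μ ω ∧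
      α = μ * Real.sin ω / (c ^ 2 * ω ^ 2 - (2 + μ) * (1 - Real.cos ω)) := by
  have e1 := congrArg Prod.fst h
  have e2 := congrArg (fun z => z.2.1) h
  have e3 := congrArg (fun z => z.2.2) h
  simp only [bifurcationMap, zero_mul, add_zero, mul_one, zero_smul, Prod.fst_zero,
    Prod.snd_zero] at e1 e2 e3
  have hα : α = μ * Real.sin ω / (c ^ 2 * ω ^ 2 - (2 + μ) * (1 - Real.cos ω)) := by
    rw [eq_div_iff hD]; linear_combination e2
  refine ⟨?_, ⟨hω, ?_⟩, hα⟩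
  -- At `a = 0` the high modes satisfy a linear fixed point equation with factor `(7/4)/(c²ω²) < 1`.
  · by_contra hp
    have hp' : 0 < ‖p‖ := norm_pos_iff.2 hp
    have hle : ‖p‖ ≤ (c ^ 2 * ω ^ 2)⁻¹ * (7 / 4 * ‖p‖) := by
      conv_lhs => rw [sub_eq_zero.1 e3]
      rw [norm_smul, norm_inv, Real.norm_of_nonneg (by linarith)]
      exact mul_le_mul_of_nonneg_left ((cutOp μ ω).le_of_opNorm_le (norm_cutOp_le μ ω hμ) p)
        (by positivity)
    rw [← div_eq_inv_mul, le_div_iff₀ (by linarith)] at hle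
    nlinarith
  -- Eliminating `α` from the two scalar equations and completing the square in `c²ω²`; the
  -- hypothesis `2 + μ < c²ω²` then selects the positive root.
  · have hsq : μ ^ 2 + 4 * (1 + μ) * Real.cos ω ^ 2 = (c ^ 2 * ω ^ 2 - (2 + μ)) ^ 2 := by
      linear_combination (-(c ^ 2 * ω ^ 2 - (2 + μ) * (1 - Real.cos ω))) * e1
        - μ * Real.sin ω * e2 - μ ^ 2 * Real.sin_sq_add_cos_sq ω
    rw [lambdaPlus, hsq, Real.sqrt_sq (by linarith)]
    ring

lemma evenPart_add (p q : Ell1) : evenPart (p + q) = evenPart p + evenPart q :=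
  funext fun _ => map_add _ _ _

lemma oddPart_add (p q : Ell1) : oddPart (p + q) = oddPart p + oddPart q :=
  funext fun _ => map_add _ _ _

lemma evenPart_smul (a : ℝ) (p : Ell1) : evenPart (a • p) = a • evenPart p :=
  funext fun _ => map_smul _ _ _

lemma oddPart_smul (a : ℝ) (p : Ell1) : oddPart (a • p) = a • oddPart p :=
  funext fun _ => map_smul _ _ _

lemma evenPart_profileVec (α : ℝ) (p : Ell1) (y : ℝ) :
    evenPart (profileVec α p) y = α * Real.cos y + evenPart p y := by
  simp only [evenPart, profileVec, map_add, map_smul, trigEval_basisVec, weight_neg, smul_eq_mul]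
  norm_num [weight]
  ring

lemma oddPart_profileVec (α : ℝ) (p : Ell1) (y : ℝ) :
    oddPart (profileVec α p) y = Real.sin y + oddPart p y := by
  simp only [oddPart, profileVec, map_add, map_smul, trigEval_basisVec, weight_neg, smul_eq_mul,
    cos_add_neg_pi_div_two]
  norm_num [weight]
  ring

lemma iteratedDeriv_two_trigEval_mul {φ ω c : ℝ} {u v : Ell1}
    (h : ∀ k : ℤ, c ^ 2 * ω ^ 2 * (k : ℝ) ^ 2 * u k = v k) (x : ℝ) :
    c ^ 2 * iteratedDeriv 2 (fun x => trigEval 0 φ (ω * x) u) x = -trigEval 0 φ (ω * x) v := by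
  rw [iteratedDeriv_comp_const_mul (f := fun y => trigEval 0 φ y u)
    ((contDiff_trigEval 0 φ u).of_le (by
      exact WithTop.coe_le_coe.2 (le_top : ((2 : ℕ) : ℕ∞) ≤ ⊤))), iteratedDeriv_trigEval]
  simp only [trigEval_apply, ← tsum_mul_left, ← tsum_neg]
  refine tsum_congr fun k => ?_
  have : k * (ω * x) + (φ + (2 : ℕ) * (Real.pi / 2)) = k * (ω * x) + φ + Real.pi := by
    push_cast; ring
  rw [this, Real.cos_add_pi, ← h k]
  ring

/-- Solutions of the equation for the Fourier coefficients are traveling waves. -/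
lemma travelingWaveOp_eq_zero {c μ ω : ℝ} {u : Ell1}
    (h : ∀ k : ℤ, c ^ 2 * ω ^ 2 * (k : ℝ) ^ 2 * u k = fullOp μ ω (u + conv u u) k) :
    travelingWaveOp c (fun x => evenPart u (ω * x), fun x => oddPart u (ω * x)) μ = 0 := by
  have h1 : ∀ x, c ^ 2 * iteratedDeriv 2 (fun x => evenPart u (ω * x)) x =
      -evenPart (fullOp μ ω (u + conv u u)) (ω * x) := iteratedDeriv_two_trigEval_mul h
  have h2 : ∀ x, c ^ 2 * iteratedDeriv 2 (fun x => oddPart u (ω * x)) x =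
      -oddPart (fullOp μ ω (u + conv u u)) (ω * x) := iteratedDeriv_two_trigEval_mul h
  have ep : ∀ x, ω * (x + 1) = ω * x + ω := fun x => by ring
  have em : ∀ x, ω * (x + -1) = ω * x - ω := fun x => by ring
  refine Prod.ext (funext fun x => ?_) (funext fun x => ?_)
  · have := h1 x
    simp only [evenPart_fullOp, evenPart_add, oddPart_add, evenPart_conv, oddPart_conv,
      Pi.add_apply, Pi.mul_apply] at this
    simp only [travelingWaveOp, secondDeriv, opD, nonlin, opA, opDelta, shift, Prod.fst_add,
      Prod.smul_fst, Pi.add_apply, Pi.smul_apply, Pi.sub_apply, Pi.mul_apply, smul_eq_mul, ep, em,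
      Prod.fst_zero, Pi.zero_apply, this]
    ring
  · have := h2 x
    simp only [oddPart_fullOp, evenPart_add, oddPart_add, evenPart_conv, oddPart_conv,
      Pi.add_apply, Pi.mul_apply] at this
    simp only [travelingWaveOp, secondDeriv, opD, nonlin, opA, opDelta, shift, Prod.snd_add,
      Prod.smul_snd, Pi.add_apply, Pi.smul_apply, Pi.sub_apply, Pi.mul_apply, Pi.neg_apply,
      smul_eq_mul, ep, em, Prod.snd_zero, Pi.zero_apply, this]
    ring

lemma profileVec_apply (α : ℝ) (p : Ell1) (k : ℤ) : profileVec α p k =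
    (α + 1) * (if k = 1 then 1 else 0) + (α - 1) * (if k = -1 then 1 else 0) + p k := by
  rw [← coord_apply k (profileVec α p)]
  simp only [profileVec, map_add, map_smul, coord_apply, basisVec_apply, smul_eq_mul]

/-- Zeros of the bifurcation map solve the equation for the Fourier coefficients. -/
lemma coeff_eq_of_bifurcationMap_eq_zero {c μ a ω α : ℝ} {p : Ell1}
    (h : bifurcationMap c ((μ, a), (ω, α, p)) = 0) (hω : c ^ 2 * ω ^ 2 ≠ 0) (k : ℤ) :
    c ^ 2 * ω ^ 2 * (k : ℝ) ^ 2 * profileVec α p k =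
      fullOp μ ω (profileVec α p + a • quadVec α p) k := by
  have e1 := congrArg Prod.fst h
  have e2 := congrArg (fun z => z.2.1) h
  have e3 := congrArg (fun z => z.2.2) h
  simp only [bifurcationMap, quadCos, quadSin, coord_apply, Prod.fst_zero,
    Prod.snd_zero] at e1 e2 e3
  set q := quadVec α p
  have hp : ∀ j, p j = (c ^ 2 * ω ^ 2)⁻¹ * (cutoff j * fullOp μ ω (p + a • q) j) := fun j => by
    rw [← cutOp_apply]
    exact congrArg (fun z : Ell1 => z j) (sub_eq_zero.1 e3)
  have hadd : ∀ (u v : Ell1) (j : ℤ), (u + v) j = u j + v j := fun _ _ _ => rfl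
  have hsmul : ∀ (u : Ell1) (j : ℤ), (a • u) j = a * u j := fun _ _ => rfl
  have hp1 : p 1 = 0 := by rw [hp]; simp [cutoff]
  have hp1' : p (-1) = 0 := by rw [hp]; simp [cutoff]
  rcases lt_or_ge k.natAbs 2 with hk | hk
  · obtain rfl | rfl | rfl : k = 0 ∨ k = 1 ∨ k = -1 := by omega
    -- Mode 0 imposes nothing: both sides vanish identically.
    · rw [fullOp_apply]
      simp
    -- The equations at `k = 1` and `k = -1` are the sum and the difference of the cosine and sine
    -- equations.
    · simp only [fullOp_apply, hadd, hsmul, profileVec_apply, hp1, hp1']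
      norm_num
      linear_combination e1 + e2
    · simp only [fullOp_apply, hadd, hsmul, profileVec_apply, neg_neg, hp1, hp1']
      norm_num
      linear_combination e2 - e1
  · have hpr : ∀ j : ℤ, 2 ≤ j.natAbs → profileVec α p j = p j := fun j hj => by
      have h1 : j ≠ 1 := by omega
      have h2 : j ≠ -1 := by omega
      simp [profileVec_apply, h1, h2]
    have hk0 : (k : ℝ) ≠ 0 := by
      have : k ≠ 0 := by omega
      exact_mod_cast this
    rw [fullOp_apply, hadd, hadd, hpr k hk, hpr (-k) (by omega), ← hadd, ← hadd, ← fullOp_apply]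
    conv_lhs => rw [hp k, cutoff, if_pos hk]
    generalize c ^ 2 * ω ^ 2 = d at hω
    field_simp

/-- The weight absorbs every power of `k`, so only the constant depends on `r`; the parameter box
need not shrink as `r` grows. -/
lemma exists_sobolevInftyNorm_le (r : ℕ) : ∃ C, 0 ≤ C ∧ ∀ (φ : ℝ) (p : Ell1),
    sobolevInftyNorm r (fun y => trigEval 0 φ y p) ≤ ENNReal.ofReal (C * ‖p‖) := by
  choose C hC0 hC using exists_norm_trigEval_le
  refine ⟨∑ k ∈ Finset.range (r + 1), C k, Finset.sum_nonneg fun k _ => hC0 k, fun φ p => ?_⟩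
  rw [Finset.sum_mul, ENNReal.ofReal_sum_of_nonneg fun k _ => mul_nonneg (hC0 k) (norm_nonneg p)]
  refine Finset.sum_le_sum fun k _ => ?_
  rw [iteratedDeriv_trigEval, MeasureTheory.eLpNorm_exponent_top]
  refine MeasureTheory.eLpNormEssSup_le_of_ae_bound (Filter.Eventually.of_forall fun y => ?_)
  have := hC (0 + k) (φ + k * (Real.pi / 2)) y p
  rwa [zero_add] at this ⊢

lemma evenPart_sub (p q : Ell1) : evenPart p - evenPart q = fun y => trigEval 0 0 y (p - q) :=
  funext fun _ => (map_sub _ _ _).symm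

lemma oddPart_sub (p q : Ell1) :
    oddPart p - oddPart q = fun y => trigEval 0 (-(Real.pi / 2)) y (p - q) :=
  funext fun _ => (map_sub _ _ _).symm

/-- The vector encoding `(t cos y, 0)`. -/
def cosVec (t : ℝ) : Ell1 := t • (basisVec 1 + basisVec (-1))

lemma evenPart_cosVec_add (t : ℝ) (p : Ell1) (y : ℝ) :
    evenPart (cosVec t + p) y = t * Real.cos y + evenPart p y := by
  simp only [evenPart, cosVec, map_add, map_smul, trigEval_basisVec, weight_neg, smul_eq_mul,
    show weight 1 = 1 / 2 by norm_num [weight], Int.cast_neg (R := ℝ), Int.cast_one (R := ℝ),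
    neg_mul, one_mul, add_zero, Real.cos_neg, pow_zero]
  ring

lemma norm_cosVec_add_sub_le (t t' : ℝ) (p p' : Ell1) :
    ‖cosVec t + p - (cosVec t' + p')‖ ≤ 2 * |t - t'| + ‖p - p'‖ := by
  have h : cosVec t + p - (cosVec t' + p') = (t - t') • (basisVec 1 + basisVec (-1)) + (p - p') := by
    simp only [cosVec]; module
  rw [h]
  refine (norm_add_le _ _).trans (add_le_add ?_ le_rfl)
  rw [norm_smul, Real.norm_eq_abs, mul_comm]
  refine mul_le_mul_of_nonneg_right ((norm_add_le _ _).trans ?_) (abs_nonneg _)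
  simp only [norm_basisVec]; norm_num

lemma travelingWaveOp_of_bifurcationMap_eq_zero {c μ a ω α : ℝ} {p : Ell1}
    (h : bifurcationMap c ((μ, a), (ω, α, p)) = 0) (hω : c ^ 2 * ω ^ 2 ≠ 0) (υ : ℝ) :
    travelingWaveOp c
      (a • periodicProfile υ ω (evenPart (cosVec (α - υ) + p)) (oddPart p)) μ = 0 := by
  have hprof : a • periodicProfile υ ω (evenPart (cosVec (α - υ) + p)) (oddPart p) =
      (fun x => evenPart (a • profileVec α p) (ω * x),
        fun x => oddPart (a • profileVec α p) (ω * x)) := by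
    refine Prod.ext (funext fun x => ?_) (funext fun x => ?_)
    · simp only [periodicProfile, Prod.smul_fst, Pi.smul_apply, smul_eq_mul, evenPart_smul,
        evenPart_profileVec, evenPart_cosVec_add]
      ring
    · simp only [periodicProfile, Prod.smul_snd, Pi.smul_apply, smul_eq_mul, oddPart_smul,
        oddPart_profileVec]
  rw [hprof]
  refine travelingWaveOp_eq_zero fun k => ?_
  -- One factor `a` splits off from the whole equation, so the nonlinearity carries a single `a` in
  -- the bifurcation map and `a = 0` remains meaningful.
  have hv : a • profileVec α p + conv (a • profileVec α p) (a • profileVec α p) =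
      a • (profileVec α p + a • quadVec α p) := by
    simp only [quadVec, map_smul, smul_apply, smul_add]
  have hk := coeff_eq_of_bifurcationMap_eq_zero h hω k
  rw [hv, map_smul]
  change _ * (a * profileVec α p k) = a * fullOp μ ω _ k
  rw [← hk]
  ring

/-- Uniform version of the local branch on a box of parameters. -/
lemma exists_branch_on_box {c : ℝ} (hc : 1 < c ^ 2) :
    ∃ (ε d : ℝ) (K : NNReal) (ψ : ℝ × ℝ → ℝ × ℝ × Ell1), 0 < ε ∧ 0 < d ∧
      (∀ x y : ℝ × ℝ, ‖x‖ ≤ ε → ‖y‖ ≤ ε → ‖ψ x - ψ y‖ ≤ K * ‖x - y‖) ∧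
      ∀ x : ℝ × ℝ, ‖x‖ ≤ ε → bifurcationMap c (x, ψ x) = 0 ∧ 0 < (ψ x).1 ∧
        2 < c ^ 2 * (ψ x).1 ^ 2 ∧ 2 + x.1 < c ^ 2 * (ψ x).1 ^ 2 ∧
        d < c ^ 2 * (ψ x).1 ^ 2 - (2 + x.1) * (1 - Real.cos (ψ x).1) := by
  obtain ⟨ω₀, hω₀, hcos, hsin, h⟩ := exists_monatomic_frequency hc
  obtain ⟨ψ, ⟨K, s, hs, hLip⟩, htend, hzero⟩ := exists_branch hω₀ hcos hsin h
  have ht : Filter.Tendsto (fun x : ℝ × ℝ => (x.1, (ψ x).1)) (nhds (0, 0)) (nhds (0, ω₀)) :=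
    (continuous_fst.tendsto' (0, 0) (0 : ℝ) rfl).prodMk_nhds
      ((continuous_fst.tendsto' (ω₀, (0 : ℝ), (0 : Ell1)) ω₀ rfl).comp htend)
  have hev : ∀ g : ℝ × ℝ → ℝ, Continuous g → 0 < g (0, ω₀) →
      ∀ᶠ x in nhds ((0, 0) : ℝ × ℝ), 0 < g (x.1, (ψ x).1) := fun g hg h0 =>
    ht.eventually (hg.continuousAt.eventually (lt_mem_nhds h0))
  have e1 := hev (fun z => z.2) (by fun_prop) hω₀
  have e2 := hev (fun z => c ^ 2 * z.2 ^ 2 - 2) (by fun_prop) (by simp only; linarith)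
  have e3 := hev (fun z => c ^ 2 * z.2 ^ 2 - (2 + z.1)) (by fun_prop) (by simp only; linarith)
  -- The denominator is `4 cos ω₀` at the base point; half of that survives nearby as the uniform
  -- lower bound `d`.
  have e4 := hev (fun z => c ^ 2 * z.2 ^ 2 - (2 + z.1) * (1 - Real.cos z.2) - 2 * Real.cos ω₀)
    (by fun_prop) (by simp only; linarith)
  have hall := (hzero.and (e1.and (e2.and (e3.and e4)))).and hs
  obtain ⟨ε, hε, hball⟩ := Metric.eventually_nhds_iff.1 hall
  have hin : ∀ x : ℝ × ℝ, ‖x‖ ≤ ε / 2 → dist x (0, 0) < ε := fun x hx => by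
    rw [← Prod.zero_eq_mk, dist_zero_right]; linarith
  refine ⟨ε / 2, 2 * Real.cos ω₀, K, ψ, by linarith, by linarith, fun x y hx hy => ?_,
    fun x hx => ?_⟩
  · simpa only [dist_eq_norm] using
      hLip.dist_le_mul x (hball (hin x hx)).2 y (hball (hin y hy)).2
  · obtain ⟨h0, h1, h2, h3, h4⟩ := (hball (hin x hx)).1
    exact ⟨h0, h1, by linarith, by linarith, by linarith⟩

end Ell1

end DiatomicFPUT

end

/-! ### Assembling the theorem. -/

open DiatomicFPUT DiatomicFPUT.Ell1

theorem proposition3p2 (c : ℝ) (hc : 1 < |c|) :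
    (∃ μω : ℝ, DiatomicFPUT.IsFrequencyThreshold c μω) ∧
    ∀ μω : ℝ, DiatomicFPUT.IsFrequencyThreshold c μω →
      ∃ μper aper : ℝ, 0 < μper ∧ μper < min μω 1 ∧ 0 < aper ∧
        -- `υ_c^μ` is well defined and `O_c(μ)`
        (∀ μ : ℝ, |μ| ≤ μper → DiatomicFPUT.upsilonDenom c μ ≠ 0) ∧
        (∃ C : ℝ, 0 < C ∧ ∀ μ : ℝ, |μ| ≤ μper → |DiatomicFPUT.upsilon c μ| ≤ C * |μ|) ∧
        -- the maps `ω_c^μ[a]`, `ψ_{c,1}^μ[a]`, `ψ_{c,2}^μ[a]`, as functions of `μ` and `a`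
        ∃ (ω : ℝ → ℝ → ℝ) (ψ₁ ψ₂ : ℝ → ℝ → ℝ → ℝ),
          (∀ μ a : ℝ, |μ| ≤ μper → |a| ≤ aper →
            (DiatomicFPUT.IsSmoothPeriodic (ψ₁ μ a) ∧ Function.Even (ψ₁ μ a)) ∧
            (DiatomicFPUT.IsSmoothPeriodic (ψ₂ μ a) ∧ Function.Odd (ψ₂ μ a)) ∧
            DiatomicFPUT.travelingWaveOp c
              (a • DiatomicFPUT.periodicProfile (DiatomicFPUT.upsilon c μ) (ω μ a)
                (ψ₁ μ a) (ψ₂ μ a)) μ = 0) ∧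
          (∀ μ : ℝ, |μ| ≤ μper →
            ω μ 0 = DiatomicFPUT.criticalFrequency c μ ∧ ψ₁ μ 0 = 0 ∧ ψ₂ μ 0 = 0) ∧
          ∀ r : ℕ, ∃ C : ℝ, 0 < C ∧ ∀ μ a a' : ℝ, |μ| ≤ μper → |a| ≤ aper → |a'| ≤ aper →
            ENNReal.ofReal |ω μ a - ω μ a'|
              + DiatomicFPUT.sobolevInftyNorm r (ψ₁ μ a - ψ₁ μ a')
              + DiatomicFPUT.sobolevInftyNorm r (ψ₂ μ a - ψ₂ μ a')
              ≤ ENNReal.ofReal (C * |a - a'|) := by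
  have hc2 : 1 < c ^ 2 := (one_lt_sq_iff_one_lt_abs c).2 hc
  refine ⟨exists_isFrequencyThreshold hc2, fun μω hμω => ?_⟩
  obtain ⟨ε, d, K, ψ, hε, hd, hLip, hψ⟩ := exists_branch_on_box hc2
  have hm : 0 < min μω 1 := lt_min hμω.1 one_pos
  set μper := min ε (min μω 1 / 2) with hμper
  have hμε : μper ≤ ε := min_le_left _ _
  have hμm : μper < min μω 1 := (min_le_right _ _).trans_lt (by linarith)
  have hbox : ∀ μ a : ℝ, |μ| ≤ μper → |a| ≤ ε → ‖((μ, a) : ℝ × ℝ)‖ ≤ ε := fun μ a hμ ha =>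
    max_le (hμ.trans hμε) ha
  have hzero : ∀ μ : ℝ, |μ| ≤ μper → (ψ (μ, 0)).2.2 = 0 ∧
      criticalFrequency c μ = (ψ (μ, 0)).1 ∧ d < upsilonDenom c μ ∧
      upsilon c μ = (ψ (μ, 0)).2.1 := by
    intro μ hμ
    obtain ⟨h0, h1, h2, h3, h4⟩ := hψ (μ, 0) (hbox μ 0 hμ (by simpa using hε.le))
    obtain ⟨hp, hcrit, hα⟩ := bifurcationMap_zero_amplitude h0
      (hμ.trans (hμm.le.trans (min_le_right _ _))) h1 h2 h3 (hd.trans h4).ne'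
    have hfreq := criticalFrequency_eq (hμω.2 μ (hμ.trans (hμm.le.trans (min_le_left _ _)))) hcrit
    have hden : upsilonDenom c μ =
        c ^ 2 * (ψ (μ, 0)).1 ^ 2 - (2 + μ) * (1 - Real.cos (ψ (μ, 0)).1) := by
      rw [upsilonDenom, hfreq, ← hcrit.2]
    exact ⟨hp, hfreq, by rw [hden]; exact h4, by rw [upsilon, hden, hfreq, ← hα]⟩
  refine ⟨μper, ε, lt_min hε (by linarith), hμm, hε,
    fun μ hμ => (hd.trans (hzero μ hμ).2.2.1).ne', ⟨d⁻¹, inv_pos.2 hd, fun μ hμ => ?_⟩,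
    fun μ a => (ψ (μ, a)).1,
    -- The prescribed leading profile has the fixed coefficient `υ_c^μ`, so the drift `α - υ_c^μ` of
    -- the cosine coefficient is moved into `ψ₁`.
    fun μ a => evenPart (cosVec ((ψ (μ, a)).2.1 - upsilon c μ) + (ψ (μ, a)).2.2),
    fun μ a => oddPart (ψ (μ, a)).2.2, fun μ a hμ ha => ?_, fun μ hμ => ?_, fun r => ?_⟩
  · have hD := (hzero μ hμ).2.2.1
    rw [upsilon, abs_div, abs_mul, abs_of_pos (hd.trans hD), mul_comm d⁻¹, ← div_eq_mul_inv]
    exact div_le_div₀ (abs_nonneg _)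
      (mul_le_of_le_one_right (abs_nonneg _) (Real.abs_sin_le_one _)) hd hD.le
  · obtain ⟨h0, -, h2, -⟩ := hψ (μ, a) (hbox μ a hμ ha)
    exact ⟨⟨isSmoothPeriodic_evenPart _, even_evenPart _⟩,
      ⟨isSmoothPeriodic_oddPart _, odd_oddPart _⟩,
      travelingWaveOp_of_bifurcationMap_eq_zero h0 (by linarith) _⟩
  · obtain ⟨hp, hfreq, -, hυ⟩ := hzero μ hμ
    refine ⟨hfreq.symm, funext fun y => ?_, funext fun y => ?_⟩
    · simp [hp, hυ, cosVec, evenPart]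
    · simp [hp, oddPart]
  · obtain ⟨C, hC0, hC⟩ := exists_sobolevInftyNorm_le r
    -- `K` comes from `ω`, `3CK` from `ψ₁` (cosine drift `2`, high modes `1`) and `CK` from `ψ₂`;
    -- the final `1` ensures positivity.
    refine ⟨(1 + 4 * C) * K + 1, by positivity, fun μ a a' hμ ha ha' => ?_⟩
    have hL := hLip (μ, a) (μ, a') (hbox μ a hμ ha) (hbox μ a' hμ ha')
    have hn : ‖((μ, a) : ℝ × ℝ) - (μ, a')‖ = |a - a'| := by
      simp [Prod.norm_def]
    rw [hn] at hL
    have hω : |(ψ (μ, a)).1 - (ψ (μ, a')).1| ≤ K * |a - a'| := (norm_fst_le _).trans hL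
    have hα : |(ψ (μ, a)).2.1 - (ψ (μ, a')).2.1| ≤ K * |a - a'| :=
      (norm_fst_le (ψ (μ, a) - ψ (μ, a')).2).trans ((norm_snd_le _).trans hL)
    have hp : ‖(ψ (μ, a)).2.2 - (ψ (μ, a')).2.2‖ ≤ K * |a - a'| :=
      (norm_snd_le (ψ (μ, a) - ψ (μ, a')).2).trans ((norm_snd_le _).trans hL)
    have hw := norm_cosVec_add_sub_le ((ψ (μ, a)).2.1 - upsilon c μ)
      ((ψ (μ, a')).2.1 - upsilon c μ) (ψ (μ, a)).2.2 (ψ (μ, a')).2.2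
    rw [sub_sub_sub_cancel_right] at hw
    rw [evenPart_sub, oddPart_sub]
    refine (add_le_add (add_le_add le_rfl (hC _ _)) (hC _ _)).trans ?_
    rw [← ENNReal.ofReal_add (abs_nonneg _) (by positivity),
      ← ENNReal.ofReal_add (by positivity) (by positivity)]
    refine ENNReal.ofReal_le_ofReal ?_
    have h1 := mul_le_mul_of_nonneg_left (hw.trans
      (show _ ≤ 3 * (K * |a - a'|) by linarith)) hC0
    have h2 := mul_le_mul_of_nonneg_left hp hC0
    have h3 := abs_nonneg (a - a')
    linarith
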